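/- Let $L/F$ be a finite extension of number fields, let $\widehat{L}$ be the normal closure of $L$ over $F$, let $G=\mathrm{Gal}(\widehat{L}/F)$, and suppose that $H=\mathrm{Gal}(\widehat{L}/L)$ is a non-normal maximal subgroup of $G$. Let $p$ be a prime, let $\zeta_p$ be a primitive $p$-th root of unity, put $a=[F(\zeta_p):F]$, and suppose that $G$ has no cyclic quotient group of order $a$. Then for every elliptic curve $E/F$ one has $E(L)[p]=E(F)[p]$, where $E(K)[p]$ denotes the group of $K$-rational points of $E$ killed by $p$ and $E(F)$ is regarded as a subgroup of $E(L)$. -/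

import Mathlib

/-- The subgroup `Gal(N/L)` of `Gal(N/F)`, for a tower of fields `N/L/F`: the `F`-automorphisms
of `N` that fix every element of (the image of) `L`. -/
def relGal (F L N : Type*) [Field F] [Field L] [Field N] [Algebra F L] [Algebra F N]
    [Algebra L N] [IsScalarTower F L N] : Subgroup (N ≃ₐ[F] N) :=
  (IsScalarTower.toAlgHom F L N).fieldRange.fixingSubgroup

/-- The group `G` has a cyclic quotient of order `a`. -/
def HasCyclicQuotientOfOrder (G : Type*) [Group G] (a : ℕ) : Prop :=
  ∃ (K : Subgroup G) (_ : K.Normal), IsCyclic (G ⧸ K) ∧ Nat.card (G ⧸ K) = a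

open Polynomial WeierstrassCurve WeierstrassCurve.Affine

namespace WeierstrassCurve.Affine.Point

variable {K : Type*} [Field K] {W : Affine K}

/-- The `x`-coordinate of an affine point, with value `0` at the point at infinity. -/
def xCoord : W.Point → K
  | .zero => 0
  | .some x _ _ => x

/-- The `y`-coordinate of an affine point, with value `0` at the point at infinity. -/
def yCoord : W.Point → K
  | .zero => 0
  | .some _ y _ => y

@[simp] lemma xCoord_neg (A : W.Point) : xCoord (-A) = xCoord A := by
  rcases A with _ | _ <;> rfl

lemma xCoord_eq_iff {A B : W.Point} (hA : A ≠ 0) (hB : B ≠ 0) :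
    xCoord A = xCoord B ↔ A = B ∨ A = -B := by
  rcases A with _ | ⟨x₁, y₁, h₁⟩
  · exact absurd rfl hA
  rcases B with _ | ⟨x₂, y₂, h₂⟩
  · exact absurd rfl hB
  exact X_eq_iff

lemma yCoord_neg {A : W.Point} (hA : A ≠ 0) : yCoord (-A) = W.negY (xCoord A) (yCoord A) := by
  rcases A with _ | ⟨x₁, y₁, h₁⟩
  · exact absurd rfl hA
  rfl

lemma equation_coord {A : W.Point} (hA : A ≠ 0) : W.Equation (xCoord A) (yCoord A) := by
  rcases A with _ | ⟨x₁, y₁, h₁⟩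
  · exact absurd rfl hA
  exact h₁.1

lemma nonsingular_coord {A : W.Point} (hA : A ≠ 0) : W.Nonsingular (xCoord A) (yCoord A) := by
  rcases A with _ | ⟨x₁, y₁, h₁⟩
  · exact absurd rfl hA
  exact h₁

lemma ext_coord {A B : W.Point} (hA : A ≠ 0) (hB : B ≠ 0) (hx : xCoord A = xCoord B)
    (hy : yCoord A = yCoord B) : A = B := by
  rcases A with _ | ⟨x₁, y₁, h₁⟩
  · exact absurd rfl hA
  rcases B with _ | ⟨x₂, y₂, h₂⟩
  · exact absurd rfl hB
  simp only [xCoord, yCoord] at hx hy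
  subst hx hy
  rfl

open scoped Classical in
/-- The slope of the line through `X` and `-T`, as a function of `X` with a simple pole at `T` and
one at infinity; it is `0` if `T` is the point at infinity. -/
noncomputable def slopeFun (X T : W.Point) : K :=
  if T = 0 then 0 else (yCoord X - yCoord (-T)) / (xCoord X - xCoord T)

@[simp] lemma slopeFun_zero (X : W.Point) : slopeFun X 0 = 0 := if_pos rfl

lemma slopeFun_of_ne (X : W.Point) {T : W.Point} (hT : T ≠ 0) :
    slopeFun X T = (yCoord X - yCoord (-T)) / (xCoord X - xCoord T) := if_neg hT

variable [DecidableEq K]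

lemma sub_mul_sub_addX {x₁ x₂ y₁ y₂ : K} (h₁ : W.Equation x₁ y₁) (h₂ : W.Equation x₂ y₂)
    (hxy : ¬(x₁ = x₂ ∧ y₁ = W.negY x₂ y₂)) :
    (x₁ - x₂) * (x₁ - W.addX x₁ x₂ (W.slope x₁ x₂ y₁ y₂)) =
      3 * x₁ ^ 2 + 2 * W.a₂ * x₁ + W.a₄ - W.a₁ * y₁ -
        W.slope x₁ x₂ y₁ y₂ * (2 * y₁ + W.a₁ * x₁ + W.a₃) := by
  have h := congrArg (Polynomial.eval x₁) (derivative_addPolynomial_slope h₁ h₂ hxy)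
  rw [addPolynomial_eq] at h
  generalize W.addX x₁ x₂ (W.slope x₁ x₂ y₁ y₂) = x₃ at h ⊢
  generalize W.slope x₁ x₂ y₁ y₂ = l at h ⊢
  simp [Cubic.toPoly, derivative_pow] at h
  linear_combination h

lemma slope_mul_sub {x₁ x₂ y₁ y₂ : K} (h₁ : W.Equation x₁ y₁) (h₂ : W.Equation x₂ y₂)
    (hxy : ¬(x₁ = x₂ ∧ y₁ = W.negY x₂ y₂)) :
    W.slope x₁ x₂ y₁ y₂ * (x₂ - x₁) = y₂ - y₁ := by
  by_cases hx : x₁ = x₂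
  · have hy : y₁ = y₂ := Y_eq_of_Y_ne h₁ h₂ hx fun h => hxy ⟨hx, h⟩
    simp [hx, hy]
  · rw [slope_of_X_ne hx]
    have : x₁ - x₂ ≠ 0 := sub_ne_zero.mpr hx
    field_simp
    ring

lemma coord_add {A B : W.Point} (hA : A ≠ 0) (hB : B ≠ 0) (hAB : A + B ≠ 0) :
    ¬(xCoord A = xCoord B ∧ yCoord A = W.negY (xCoord B) (yCoord B)) ∧
    xCoord (A + B) = W.addX (xCoord A) (xCoord B)
      (W.slope (xCoord A) (xCoord B) (yCoord A) (yCoord B)) ∧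
    yCoord (A + B) = W.addY (xCoord A) (xCoord B) (yCoord A)
      (W.slope (xCoord A) (xCoord B) (yCoord A) (yCoord B)) := by
  rcases A with _ | ⟨x₁, y₁, h₁⟩
  · exact absurd rfl hA
  rcases B with _ | ⟨x₂, y₂, h₂⟩
  · exact absurd rfl hB
  have hxy : ¬(x₁ = x₂ ∧ y₁ = W.negY x₂ y₂) := fun h => hAB (add_of_Y_eq h.1 h.2)
  rw [add_some hxy]
  exact ⟨hxy, rfl, rfl⟩

/-- The cocycle identity of the slopes. -/
lemma slopeFun_add_of_ne {X P T : W.Point} (hX : X ≠ 0) (hP : P ≠ 0) (hT : T ≠ 0) (hTP : T ≠ P)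
    (hXP : xCoord X ≠ xCoord P) (hXPT : xCoord (X + P) ≠ xCoord T)
    (hXTP : xCoord X ≠ xCoord (T - P)) :
    slopeFun (X + P) T = slopeFun X (T - P) - slopeFun X (-P) +
      W.slope (xCoord P) (xCoord T) (yCoord P) (yCoord (-T)) := by
  have hnT : -T ≠ 0 := neg_ne_zero.mpr hT
  have hPX : P + X ≠ 0 := fun h => hXP (by rw [← neg_eq_of_add_eq_zero_right h, xCoord_neg])
  have hPT : P + -T ≠ 0 := fun h => hTP (by simpa using (eq_neg_of_add_eq_zero_left h).symm)
  obtain ⟨hxy₁, hx₁, hy₁⟩ := coord_add hP hX hPX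
  obtain ⟨hxy₂, hx₂, hy₂⟩ := coord_add hP hnT hPT
  have e₁ := sub_mul_sub_addX (equation_coord hP) (equation_coord hX) hxy₁
  have e₂ := sub_mul_sub_addX (equation_coord hP) (equation_coord hnT) hxy₂
  have l₁ := slope_mul_sub (equation_coord hP) (equation_coord hX) hxy₁
  have l₂ := slope_mul_sub (equation_coord hP) (equation_coord hnT) hxy₂
  have hneg : T - P = -(P + -T) := by abel
  rw [hneg, xCoord_neg] at hXTP
  rw [slopeFun_of_ne _ hT, slopeFun_of_ne _ (sub_ne_zero.mpr hTP),
    slopeFun_of_ne _ (neg_ne_zero.mpr hP), hneg, neg_neg, neg_neg, xCoord_neg, xCoord_neg]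
  rw [add_comm X P] at hXPT ⊢
  simp only [xCoord_neg] at *
  have hs : W.slope (xCoord P) (xCoord X) (yCoord P) (yCoord X) =
      (yCoord X - yCoord P) / (xCoord X - xCoord P) := by
    rw [eq_div_iff (sub_ne_zero.mpr hXP), l₁]
  rw [← hs]
  clear hs
  set n := W.slope (xCoord P) (xCoord X) (yCoord P) (yCoord X)
  set M := W.slope (xCoord P) (xCoord T) (yCoord P) (yCoord (-T))
  rw [hx₁] at hXPT
  rw [hx₂] at hXTP
  rw [hx₁, hy₁, hx₂, hy₂]
  have d₁ := sub_ne_zero.mpr hXPT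
  have d₂ := sub_ne_zero.mpr hXTP
  suffices h : (W.addY (xCoord P) (xCoord X) (yCoord P) n - yCoord (-T)) *
      (xCoord X - W.addX (xCoord P) (xCoord T) M) =
      (yCoord X - W.addY (xCoord P) (xCoord T) (yCoord P) M + (M - n) *
        (xCoord X - W.addX (xCoord P) (xCoord T) M)) *
          (W.addX (xCoord P) (xCoord X) n - xCoord T) by
    field_simp
    linear_combination h
  have s₁ : W.addX (xCoord P) (xCoord X) n =
    n ^ 2 + W.a₁ * n - W.a₂ - xCoord P - xCoord X := rfl
  have s₂ : W.addX (xCoord P) (xCoord T) M =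
    M ^ 2 + W.a₁ * M - W.a₂ - xCoord P - xCoord T := rfl
  have yT : yCoord (-T) = yCoord P + M * (xCoord T - xCoord P) := by linear_combination -l₂
  have yX : yCoord X = yCoord P + n * (xCoord X - xCoord P) := by linear_combination -l₁
  simp only [addY, negAddY, negY]
  rw [yT, yX]
  set x12 := W.addX (xCoord P) (xCoord X) n
  set x23 := W.addX (xCoord P) (xCoord T) M
  linear_combination -(M + n + W.a₁) * (e₁ - e₂) -
    (2 * yCoord P + W.a₁ * xCoord P + W.a₃) * (s₁ - s₂)

end WeierstrassCurve.Affine.Point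

namespace WeierstrassCurve.Affine.Point

variable {K : Type*} [Field K] {W : Affine K}

open CoordinateRing
open scoped Polynomial.Bivariate

/-- The maximal ideal of the coordinate ring at a nonzero point. -/
noncomputable def pointIdeal (A : W.Point) : Ideal W.CoordinateRing :=
  XYIdeal W (xCoord A) (C (yCoord A))

lemma pointIdeal_neg_mul {A : W.Point} (hA : A ≠ 0) :
    pointIdeal (-A) * pointIdeal A = Ideal.span {XClass W (xCoord A)} := by
  rw [pointIdeal, pointIdeal, xCoord_neg, yCoord_neg hA, XYIdeal_neg_mul (nonsingular_coord hA),
    XIdeal]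

lemma eval_eq_zero_of_mem_pointIdeal {A : W.Point} (hA : A ≠ 0) {a b : K[X]}
    (h : a • (1 : W.CoordinateRing) + b • CoordinateRing.mk W Y ∈ pointIdeal A) :
    a.eval (xCoord A) + b.eval (xCoord A) * yCoord A = 0 := by
  let φ : W.CoordinateRing →+* K :=
    AdjoinRoot.lift (Polynomial.evalRingHom (xCoord A)) (yCoord A) (by
      have := equation_coord hA
      rwa [Equation, ← eval₂_evalRingHom] at this)
  have hle : pointIdeal A ≤ RingHom.ker φ := by
    rw [pointIdeal, XYIdeal, Ideal.span_le]
    rintro z (rfl | rfl)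
    · simp [φ, RingHom.mem_ker, XClass]
    · simp [φ, RingHom.mem_ker, YClass]
  have h0 := RingHom.mem_ker.mp (hle h)
  simpa [φ, CoordinateRing.smul] using h0

lemma natDegree_norm_XClass (x : K) : (Algebra.norm K[X] (XClass W x)).natDegree = 2 := by
  have h := degree_norm_smul_basis (W' := W) (X - C x) 0
  have e : XClass W x = (X - C x) • (1 : W.CoordinateRing) + (0 : K[X]) • CoordinateRing.mk W Y := by
    rw [zero_smul, add_zero, CoordinateRing.smul, mul_one, XClass]
  rw [e]
  apply natDegree_eq_of_degree_eq_some
  rw [h, degree_X_sub_C, degree_zero]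
  rfl

instance : Module.Finite K[X] W.CoordinateRing := .of_basis (CoordinateRing.basis W)

variable [DecidableEq K]

lemma exists_prod_pointIdeal_eq_span {ι : Type*} (s : Finset ι) (A : ι → W.Point)
    (hA : ∀ i ∈ s, A i ≠ 0) (hs : ∑ i ∈ s, A i = 0) :
    ∃ u : W.CoordinateRing, u ≠ 0 ∧ ∏ i ∈ s, pointIdeal (A i) = Ideal.span {u} := by
  have key : ∀ t : Finset ι, t ⊆ s →
      ∃ I : (FractionalIdeal (nonZeroDivisors W.CoordinateRing) W.FunctionField)ˣ,
        (I : FractionalIdeal (nonZeroDivisors W.CoordinateRing) W.FunctionField) =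
          ((∏ i ∈ t, pointIdeal (A i) : Ideal W.CoordinateRing) : FractionalIdeal _ _) ∧
        ClassGroup.mk W.FunctionField I = (toClass (∑ i ∈ t, A i)).toMul := by
    classical
    intro t
    induction t using Finset.induction_on with
    | empty => exact fun _ => ⟨1, by simp, by simp⟩
    | insert i t hi ih =>
      intro ht
      obtain ⟨I, hI, hcl⟩ := ih fun j hj => ht (Finset.mem_insert_of_mem hj)
      have hAi : A i ≠ 0 := hA i (ht (Finset.mem_insert_self i t))
      have hcli : ClassGroup.mk W.FunctionField (XYIdeal' (nonsingular_coord hAi)) =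
          (toClass (A i)).toMul := by
        generalize A i = B at hAi ⊢
        rcases B with _ | ⟨x, y, h⟩
        · exact absurd rfl hAi
        · rfl
      refine ⟨XYIdeal' (nonsingular_coord hAi) * I, ?_, ?_⟩
      · rw [Units.val_mul, hI, Finset.prod_insert hi, FractionalIdeal.coeIdeal_mul]
        rfl
      · rw [map_mul, hcli, hcl, Finset.sum_insert hi, map_add]
        rfl
  obtain ⟨I, hI, hcl⟩ := key s subset_rfl
  rw [hs, _root_.map_zero] at hcl
  obtain ⟨u, h0, hu⟩ := (ClassGroup.mk_eq_one_of_coe_ideal hI).mp hcl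
  exact ⟨u, h0, hu⟩

/-- Points that sum to zero are the zeros of a function with a pole of bounded order at infinity,
up to replacing all the points by their negatives. -/
lemma exists_eval_eq_zero {ι : Type*} (s : Finset ι) (m : ℕ) (hm : s.card = 2 * m + 1)
    (A : ι → W.Point) (hA : ∀ i ∈ s, A i ≠ 0) (hs : ∑ i ∈ s, A i = 0) :
    ∃ a b : K[X], (a ≠ 0 ∨ b ≠ 0) ∧ a.degree ≤ m ∧ b.degree < m ∧
      ((∀ i ∈ s, a.eval (xCoord (A i)) + b.eval (xCoord (A i)) * yCoord (A i) = 0) ∨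
       ∀ i ∈ s, a.eval (xCoord (-A i)) + b.eval (xCoord (-A i)) * yCoord (-A i) = 0) := by
  obtain ⟨u, hu0, hu⟩ := exists_prod_pointIdeal_eq_span s A hA hs
  obtain ⟨v, hv0, hv⟩ := exists_prod_pointIdeal_eq_span s (fun i => -A i)
    (fun i hi => neg_ne_zero.mpr (hA i hi)) (by rw [Finset.sum_neg_distrib, hs, neg_zero])
  have hdeg : (Algebra.norm K[X] u).natDegree + (Algebra.norm K[X] v).natDegree =
      2 * (2 * m + 1) := by
    have hassoc : Associated (v * u) (∏ i ∈ s, XClass W (xCoord (A i))) := by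
      rw [← Ideal.span_singleton_eq_span_singleton, ← Ideal.span_singleton_mul_span_singleton,
        ← hu, ← hv, ← Finset.prod_mul_distrib, ← Ideal.prod_span_singleton]
      exact Finset.prod_congr rfl fun i hi => pointIdeal_neg_mul (hA i hi)
    have hN := hassoc.map (Algebra.norm K[X])
    have hd := natDegree_eq_of_degree_eq (degree_eq_degree_of_associated hN)
    rw [map_mul, map_prod, natDegree_mul (Algebra.norm_ne_zero_iff.mpr hv0)
      (Algebra.norm_ne_zero_iff.mpr hu0), natDegree_prod _ _ fun i _ =>
      Algebra.norm_ne_zero_iff.mpr (XClass_ne_zero _)] at hd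
    simp only [natDegree_norm_XClass, Finset.sum_const, hm, smul_eq_mul] at hd
    omega
  have main : ∀ (B : ι → W.Point) (w : W.CoordinateRing), (∀ i ∈ s, B i ≠ 0) → w ≠ 0 →
      ∏ i ∈ s, pointIdeal (B i) = Ideal.span {w} → (Algebra.norm K[X] w).natDegree ≤ 2 * m + 1 →
      ∃ a b : K[X], (a ≠ 0 ∨ b ≠ 0) ∧ a.degree ≤ m ∧ b.degree < m ∧
        ∀ i ∈ s, a.eval (xCoord (B i)) + b.eval (xCoord (B i)) * yCoord (B i) = 0 := by
    intro B w hB hw0 hw hwd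
    obtain ⟨a, b, rfl⟩ := exists_smul_basis_eq w
    have hle := degree_le_of_natDegree_le hwd
    rw [degree_norm_smul_basis, max_le_iff] at hle
    refine ⟨a, b, ?_, ?_, ?_, fun i hi => eval_eq_zero_of_mem_pointIdeal (hB i hi) ?_⟩
    · by_contra! h
      exact hw0 (by simp [h.1, h.2])
    · by_cases h0 : a = 0
      · simp [h0]
      · rw [degree_eq_natDegree h0] at hle ⊢
        have h1 := hle.1
        rw [two_nsmul] at h1
        have : a.natDegree + a.natDegree ≤ 2 * m + 1 := by exact_mod_cast h1
        exact_mod_cast (by omega : a.natDegree ≤ m)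
    · by_cases h0 : b = 0
      · simp [h0]
      · rw [degree_eq_natDegree h0] at hle ⊢
        have h1 := hle.2
        rw [two_nsmul] at h1
        have : b.natDegree + b.natDegree + 3 ≤ 2 * m + 1 := by exact_mod_cast h1
        exact_mod_cast (by omega : b.natDegree < m)
    · have : Ideal.span {a • (1 : W.CoordinateRing) + b • CoordinateRing.mk W Y} ≤ pointIdeal (B i) := by
        rw [← hw]
        exact Ideal.prod_le_inf.trans (Finset.inf_le hi)
      exact this (Ideal.mem_span_singleton_self _)
  rcases le_total (Algebra.norm K[X] u).natDegree (Algebra.norm K[X] v).natDegree with h | h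
  · obtain ⟨a, b, h1, h2, h3, h4⟩ := main A u hA hu0 hu (by omega)
    exact ⟨a, b, h1, h2, h3, .inl h4⟩
  · obtain ⟨a, b, h1, h2, h3, h4⟩ := main (fun i => -A i) v
      (fun i hi => neg_ne_zero.mpr (hA i hi)) hv0 hv (by omega)
    exact ⟨a, b, h1, h2, h3, .inr h4⟩

/-- A function with few poles and many zeros vanishes. -/
lemma eq_zero_of_eval_eq_zero {ι : Type*} (s : Finset ι) (m : ℕ) (hm : 2 * m < s.card)
    (A : ι → W.Point) (hA : ∀ i ∈ s, A i ≠ 0) (hinj : Set.InjOn (fun i => xCoord (A i)) s)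
    {a b : K[X]} (ha : a.degree ≤ m) (hb : b.degree + 1 < m)
    (h : ∀ i ∈ s, a.eval (xCoord (A i)) + b.eval (xCoord (A i)) * yCoord (A i) = 0) :
    a = 0 ∧ b = 0 := by
  apply smul_basis_eq_zero (W' := W)
  rw [← Algebra.norm_eq_zero_iff (R := K[X])]
  apply eq_zero_of_degree_lt_of_eval_finset_eq_zero (s.image fun i => xCoord (A i))
  · rw [Finset.card_image_of_injOn hinj, degree_norm_smul_basis, max_lt_iff]
    constructor
    · by_cases h0 : a = 0
      · simp [h0]
      · rw [degree_eq_natDegree h0] at ha ⊢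
        have : a.natDegree ≤ m := by exact_mod_cast ha
        rw [two_nsmul]
        have h2 : a.natDegree + a.natDegree < s.card := by omega
        exact_mod_cast h2
    · by_cases h0 : b = 0
      · simp [h0]
      · rw [degree_eq_natDegree h0] at hb ⊢
        have : b.natDegree + 1 < m := by exact_mod_cast hb
        rw [two_nsmul]
        have h2 : b.natDegree + b.natDegree + 3 < s.card := by omega
        exact_mod_cast h2
  · simp only [Finset.mem_image, forall_exists_index, and_imp, forall_apply_eq_imp_iff₂]
    intro i hi
    have e := ((equation_iff (W := W) _ _).mp <| equation_coord (hA i hi))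
    have h0 := h i hi
    rw [norm_smul_basis]
    simp only [eval_sub, eval_mul, eval_add, eval_pow, eval_C, eval_X]
    linear_combination (a.eval (xCoord (A i)) - b.eval (xCoord (A i)) * yCoord (A i) -
      b.eval (xCoord (A i)) * (W.a₁ * xCoord (A i) + W.a₃)) * h0 +
      (b.eval (xCoord (A i))) ^ 2 * e

end WeierstrassCurve.Affine.Point

section PartialFractions

variable {K ι : Type*} [Field K] [DecidableEq ι]

open Lagrange

lemma degree_C_mul_le_degree (c : K) (q : K[X]) : (C c * q).degree ≤ q.degree := by
  rw [← smul_eq_C_mul]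
  exact degree_smul_le c q

lemma eval_sum_nodal_erase (s : Finset ι) (v : ι → K) (f : ι → K) {i : ι} (hi : i ∈ s) :
    (∑ j ∈ s, C (f j) * nodal (s.erase j) v).eval (v i) =
      f i * (nodal (s.erase i) v).eval (v i) := by
  rw [eval_finsetSum, Finset.sum_eq_single i]
  · simp
  · intro j _ hji
    rw [eval_mul, eval_nodal_at_node (Finset.mem_erase.mpr ⟨hji.symm, hi⟩), mul_zero]
  · exact fun h => absurd hi h

lemma eval_nodal_erase_self_ne_zero {s : Finset ι} {v : ι → K} (hv : Set.InjOn v s) {i : ι}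
    (hi : i ∈ s) : (nodal (s.erase i) v).eval (v i) ≠ 0 := by
  rw [eval_nodal, Finset.prod_ne_zero_iff]
  intro j hj
  rw [sub_ne_zero]
  exact fun h => (Finset.mem_erase.mp hj).1 (hv hi (Finset.mem_of_mem_erase hj) h).symm

lemma degree_sum_nodal_erase_lt (s : Finset ι) (v : ι → K) (f : ι → K) :
    (∑ j ∈ s, C (f j) * nodal (s.erase j) v).degree < s.card := by
  refine (degree_sum_le _ _).trans_lt ((Finset.sup_lt_iff (WithBot.bot_lt_coe _)).mpr ?_)
  intro j hj
  refine (degree_C_mul_le_degree _ _).trans_lt ?_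
  rw [degree_nodal]
  exact_mod_cast Finset.card_erase_lt_of_mem hj

lemma eq_sum_nodal_erase {s : Finset ι} {v : ι → K} (hv : Set.InjOn v s) {b : K[X]}
    (hb : b.degree < s.card) :
    b = ∑ j ∈ s, C (b.eval (v j) / (derivative (nodal s v)).eval (v j)) *
      nodal (s.erase j) v := by
  refine eq_of_degrees_lt_of_eval_index_eq s hv hb (degree_sum_nodal_erase_lt s v _) ?_
  intro i hi
  rw [eval_sum_nodal_erase s v _ hi, eval_nodal_derivative_eval_node_eq hi,
    div_mul_cancel₀ _ (eval_nodal_erase_self_ne_zero hv hi)]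

lemma degree_sum_nodal_erase_add_one_lt (s : Finset ι) (v : ι → K) (f : ι → K)
    (hf : ∑ j ∈ s, f j = 0) :
    (∑ j ∈ s, C (f j) * nodal (s.erase j) v).degree + 1 < s.card := by
  have hlt := degree_sum_nodal_erase_lt s v f
  have hcoeff : (∑ j ∈ s, C (f j) * nodal (s.erase j) v).coeff (s.card - 1) = 0 := by
    rw [finsetSum_coeff, ← hf]
    refine Finset.sum_congr rfl fun j hj => ?_
    have h1 : (nodal (s.erase j) v).coeff (s.card - 1) = 1 := by
      have := nodal_monic (s := s.erase j) (v := v)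
      rwa [Monic, leadingCoeff, natDegree_nodal, Finset.card_erase_of_mem hj] at this
    rw [coeff_C_mul, h1, mul_one]
  generalize (∑ j ∈ s, C (f j) * nodal (s.erase j) v) = b at *
  by_cases h0 : b = 0
  · simp [h0]
  · rw [degree_eq_natDegree h0] at hlt ⊢
    have h1 : b.natDegree < s.card := by exact_mod_cast hlt
    have h2 : b.natDegree ≠ s.card - 1 := by
      intro h
      rw [← h] at hcoeff
      exact h0 (leadingCoeff_eq_zero.mp hcoeff)
    have h3 : b.natDegree + 1 < s.card := by omega
    exact_mod_cast h3

lemma eval_nodal_erase_eq {s : Finset ι} {v : ι → K} {i : ι} (hi : i ∈ s) {z : K} (hz : z ≠ v i) :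
    (nodal (s.erase i) v).eval z = (nodal s v).eval z / (z - v i) := by
  rw [eq_div_iff (sub_ne_zero.mpr hz), nodal_eq_mul_nodal_erase hi]
  simp [mul_comm]

end PartialFractions

namespace WeierstrassCurve.Affine.Point

variable {K : Type*} [Field K] {W : Affine K} [DecidableEq K]

/-- A constant plus a combination of the functions `slopeFun · T` for the first `n` multiples `T`
of `P`. -/
noncomputable def slopeSum (P : W.Point) (n : ℕ) (c : K) (r : W.Point → K) (X : W.Point) : K :=
  c + ∑ j ∈ Finset.range n, r (j • P) * slopeFun X (j • P)

lemma sum_range_nsmul_eq {M : Type*} [AddCommMonoid M] {P : W.Point} {m : ℕ}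
    (hP : (2 * m + 1) • P = 0) (f : W.Point → M) :
    ∑ j ∈ Finset.range (2 * m + 1), f (j • P) =
      ∑ i ∈ Finset.range m, (f ((i + 1) • P) + f (-((i + 1) • P))) + f 0 := by
  rw [Finset.sum_range_succ', zero_smul, two_mul, Finset.sum_range_add, Finset.sum_add_distrib]
  congr 2
  rw [← Finset.sum_range_reflect]
  refine Finset.sum_congr rfl fun i hi => ?_
  have hi' := Finset.mem_range.mp hi
  congr 1
  rw [eq_neg_iff_add_eq_zero, ← add_smul, ← hP]
  congr 1
  omega

section Torsion

variable {P : W.Point} {m : ℕ}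

lemma nsmul_ne_zero_of_lt (hP : addOrderOf P = 2 * m + 1) {k : ℕ} (h0 : k ≠ 0)
    (hk : k < 2 * m + 1) : k • P ≠ 0 := by
  intro h
  rw [← addOrderOf_dvd_iff_nsmul_eq_zero, hP] at h
  exact absurd (Nat.le_of_dvd (Nat.pos_of_ne_zero h0) h) (by omega)

lemma injOn_xCoord_nsmul (hP : addOrderOf P = 2 * m + 1) :
    Set.InjOn (fun i : ℕ => xCoord ((i + 1) • P)) (Finset.range m) := by
  intro i hi j hj h
  have hi' := Finset.mem_range.mp hi
  have hj' := Finset.mem_range.mp hj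
  rcases (xCoord_eq_iff (nsmul_ne_zero_of_lt hP (by omega) (by omega))
    (nsmul_ne_zero_of_lt hP (by omega) (by omega))).mp h with h | h
  · have := nsmul_injOn_Iio_addOrderOf (x := P) (by simp; omega) (by simp; omega) h
    omega
  · rw [eq_neg_iff_add_eq_zero, ← add_smul] at h
    exact absurd h (nsmul_ne_zero_of_lt hP (by omega) (by omega))

lemma yCoord_nsmul_ne (hP : addOrderOf P = 2 * m + 1) {i : ℕ} (hi : i < m) :
    yCoord ((i + 1) • P) ≠ yCoord (-((i + 1) • P)) := by
  intro h
  have h0 : (i + 1) • P ≠ 0 := nsmul_ne_zero_of_lt hP (by omega) (by omega)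
  have := ext_coord h0 (neg_ne_zero.mpr h0) (xCoord_neg _).symm h
  rw [eq_neg_iff_add_eq_zero, ← add_smul] at this
  exact absurd this (nsmul_ne_zero_of_lt hP (by omega) (by omega))

lemma ne_zero_of_notMem {C : AddSubgroup W.Point} {X : W.Point} (hX : X ∉ C) : X ≠ 0 :=
  fun h => hX (h ▸ C.zero_mem)

lemma xCoord_ne_of_notMem {C : AddSubgroup W.Point} {X T : W.Point} (hX : X ∉ C) (hT : T ∈ C)
    (hT0 : T ≠ 0) : xCoord X ≠ xCoord T := by
  intro h
  rcases (xCoord_eq_iff (ne_zero_of_notMem hX) hT0).mp h with h | h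
  · exact hX (h ▸ hT)
  · exact hX (h ▸ C.neg_mem hT)

lemma injOn_xCoord_add_nsmul (hP : addOrderOf P = 2 * m + 1) {Q : W.Point}
    (hQ : Q ∉ AddSubgroup.zmultiples P) (hQm : (2 * m + 1) • Q = 0) :
    Set.InjOn (fun j : ℕ => xCoord (Q + j • P)) (Finset.range (2 * m + 1)) := by
  intro i hi j hj h
  have hi' := Finset.mem_range.mp hi
  have hj' := Finset.mem_range.mp hj
  have hmem : ∀ k : ℕ, k • P ∈ AddSubgroup.zmultiples P :=
    fun k => AddSubgroup.nsmul_mem _ (AddSubgroup.mem_zmultiples P) k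
  have h0 : ∀ k : ℕ, Q + k • P ≠ 0 := fun k hk =>
    hQ (by rw [eq_neg_of_add_eq_zero_left hk]; exact AddSubgroup.neg_mem _ (hmem k))
  rcases (xCoord_eq_iff (h0 i) (h0 j)).mp h with h | h
  · exact nsmul_injOn_Iio_addOrderOf (x := P) (by simp; omega) (by simp; omega)
      (add_left_cancel h)
  · refine absurd ?_ hQ
    have h2 : (2 : ℕ) • Q = -((i + j) • P) := by
      rw [add_smul, two_nsmul]
      have := eq_neg_iff_add_eq_zero.mp h
      rw [eq_neg_iff_add_eq_zero, ← this]
      abel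
    have hQ2 : Q = (m + 1) • (2 : ℕ) • Q := by
      rw [← mul_smul, show (m + 1) * 2 = (2 * m + 1) + 1 by ring, add_smul, hQm, zero_add, one_smul]
    rw [hQ2, h2]
    exact AddSubgroup.nsmul_mem _ (AddSubgroup.neg_mem _ (hmem _)) _

/-- Clearing denominators in `slopeSum`. -/
lemma slopeSum_mul_nodal (hP : addOrderOf P = 2 * m + 1) (c : K) (r : W.Point → K) {X : W.Point}
    (hX : X ∉ AddSubgroup.zmultiples P) :
    slopeSum P (2 * m + 1) c r X *
        (Lagrange.nodal (Finset.range m) fun i => xCoord ((i + 1) • P)).eval (xCoord X) =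
      (C c * Lagrange.nodal (Finset.range m) (fun i => xCoord ((i + 1) • P)) +
        ∑ i ∈ Finset.range m, C (-(r ((i + 1) • P) * yCoord (-((i + 1) • P)) +
          r (-((i + 1) • P)) * yCoord ((i + 1) • P))) *
          Lagrange.nodal ((Finset.range m).erase i) fun i => xCoord ((i + 1) • P)).eval (xCoord X) +
      (∑ i ∈ Finset.range m, C (r ((i + 1) • P) + r (-((i + 1) • P))) *
          Lagrange.nodal ((Finset.range m).erase i)
            fun i => xCoord ((i + 1) • P)).eval (xCoord X) * yCoord X := by
  have hP0 : (2 * m + 1) • P = 0 := by rw [← hP, addOrderOf_nsmul_eq_zero]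
  rw [slopeSum, sum_range_nsmul_eq hP0 fun T => r T * slopeFun X T]
  simp only [slopeFun_zero, mul_zero, add_zero, eval_add, eval_finsetSum, eval_mul, eval_C,
    add_mul, Finset.sum_mul]
  rw [add_assoc, ← Finset.sum_add_distrib]
  congr 1
  refine Finset.sum_congr rfl fun i hi => ?_
  have hi' := Finset.mem_range.mp hi
  have hT0 : (i + 1) • P ≠ 0 := nsmul_ne_zero_of_lt hP (by omega) (by omega)
  have hx : xCoord X ≠ xCoord ((i + 1) • P) :=
    xCoord_ne_of_notMem hX (AddSubgroup.nsmul_mem _ (AddSubgroup.mem_zmultiples P) _) hT0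
  rw [eval_nodal_erase_eq hi hx, slopeFun_of_ne _ hT0, slopeFun_of_ne _ (neg_ne_zero.mpr hT0),
    xCoord_neg, neg_neg]
  have hd := sub_ne_zero.mpr hx
  field_simp
  ring

/-- A combination of slope functions with few poles that vanishes on a coset is zero. -/
lemma slopeSum_eq_zero (hP : addOrderOf P = 2 * m + 1) {Q : W.Point}
    (hQ : Q ∉ AddSubgroup.zmultiples P) (hQm : (2 * m + 1) • Q = 0) {c : K} {r : W.Point → K}
    (hr : ∑ j ∈ Finset.range (2 * m + 1), r (j • P) = 0) (hr0 : r 0 = 0)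
    (h : ∀ T ∈ AddSubgroup.zmultiples P, slopeSum P (2 * m + 1) c r (Q + T) = 0) :
    c = 0 ∧ ∀ T ∈ AddSubgroup.zmultiples P, r T = 0 := by
  have hP0 : (2 * m + 1) • P = 0 := by rw [← hP, addOrderOf_nsmul_eq_zero]
  have hmem : ∀ k : ℕ, k • P ∈ AddSubgroup.zmultiples P :=
    fun k => AddSubgroup.nsmul_mem _ (AddSubgroup.mem_zmultiples P) k
  have hQT : ∀ k : ℕ, Q + k • P ∉ AddSubgroup.zmultiples P := fun k hk =>
    hQ ((AddSubgroup.add_mem_cancel_right _ (hmem k)).mp hk)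
  rw [sum_range_nsmul_eq hP0, hr0, add_zero] at hr
  have hinj := injOn_xCoord_nsmul hP
  have key := fun k (_ : k ∈ Finset.range (2 * m + 1)) => slopeSum_mul_nodal hP c r (hQT k)
  simp only [h _ (hmem _), zero_mul] at key
  set t : ℕ → K := fun i => -(r ((i + 1) • P) * yCoord (-((i + 1) • P)) +
          r (-((i + 1) • P)) * yCoord ((i + 1) • P)) with ht
  set s : ℕ → K := fun i => r ((i + 1) • P) + r (-((i + 1) • P)) with hs
  set v : ℕ → K := fun i => xCoord ((i + 1) • P)
  obtain ⟨hA, hB⟩ := eq_zero_of_eval_eq_zero (Finset.range (2 * m + 1)) m (by simp)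
    (fun k => Q + k • P) (fun k _ => ne_zero_of_notMem (hQT k))
    (injOn_xCoord_add_nsmul hP hQ hQm)
    (a := C c * Lagrange.nodal (Finset.range m) v +
      ∑ i ∈ Finset.range m, C (t i) * Lagrange.nodal ((Finset.range m).erase i) v)
    (b := ∑ i ∈ Finset.range m, C (s i) * Lagrange.nodal ((Finset.range m).erase i) v)
    (by
      refine (degree_add_le _ _).trans (max_le ((degree_C_mul_le_degree _ _).trans ?_) ?_)
      · rw [Lagrange.degree_nodal, Finset.card_range]
      · simpa using (degree_sum_nodal_erase_lt (Finset.range m) v t).le)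
    (by
      simpa using degree_sum_nodal_erase_add_one_lt (Finset.range m) v s hr)
    (fun k hk => (key k hk).symm)
  have hs0 : ∀ i < m, s i = 0 := by
    intro i hi
    have e := eval_sum_nodal_erase (Finset.range m) v s (Finset.mem_range.mpr hi)
    rw [hB, eval_zero] at e
    exact (mul_eq_zero.mp e.symm).resolve_right
      (eval_nodal_erase_self_ne_zero hinj (Finset.mem_range.mpr hi))
  have ht0 : ∀ i < m, t i = 0 := by
    intro i hi
    have e := congrArg (eval (v i)) hA
    rw [eval_add, eval_mul, Lagrange.eval_nodal_at_node (Finset.mem_range.mpr hi), mul_zero,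
      zero_add, eval_sum_nodal_erase (Finset.range m) v t (Finset.mem_range.mpr hi),
      eval_zero] at e
    exact (mul_eq_zero.mp e).resolve_right
      (eval_nodal_erase_self_ne_zero hinj (Finset.mem_range.mpr hi))
  have hrT : ∀ i < m, r ((i + 1) • P) = 0 ∧ r (-((i + 1) • P)) = 0 := by
    intro i hi
    have e1 : r ((i + 1) • P) + r (-((i + 1) • P)) = 0 := hs0 i hi
    have e2 : -(r ((i + 1) • P) * yCoord (-((i + 1) • P)) +
          r (-((i + 1) • P)) * yCoord ((i + 1) • P)) = 0 := ht0 i hi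
    have e3 : r ((i + 1) • P) * (yCoord ((i + 1) • P) - yCoord (-((i + 1) • P))) = 0 := by
      linear_combination e2 + yCoord ((i + 1) • P) * e1
    have e4 := (mul_eq_zero.mp e3).resolve_right (sub_ne_zero.mpr (yCoord_nsmul_ne hP hi))
    exact ⟨e4, by simpa [e4] using e1⟩
  constructor
  · rw [Finset.sum_eq_zero fun i hi => by rw [ht0 i (Finset.mem_range.mp hi)]; simp, add_zero] at hA
    simpa [Lagrange.nodal_ne_zero] using hA
  · intro T hT
    have hfin : IsOfFinAddOrder P := addOrderOf_pos_iff.mp (by omega)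
    rw [hfin.mem_zmultiples_iff_mem_range_addOrderOf, hP] at hT
    obtain ⟨j, hj, rfl⟩ := Finset.mem_image.mp hT
    have hj' := Finset.mem_range.mp hj
    rcases Nat.eq_zero_or_pos j with rfl | hj0
    · simpa using hr0
    · rcases le_or_gt j m with hjm | hjm
      · have := (hrT (j - 1) (by omega)).1
        rwa [Nat.sub_add_cancel hj0] at this
      · have := (hrT (2 * m - j) (by omega)).2
        have e : j • P = -((2 * m - j + 1) • P) := by
          rw [eq_neg_iff_add_eq_zero, ← add_smul, ← hP0]
          congr 1
          omega
        rwa [e]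

/-- Up to sign, there is a nonzero combination of slope functions vanishing on a given coset. -/
lemma exists_slopeSum_eq_zero (hP : addOrderOf P = 2 * m + 1) {Q : W.Point}
    (hQ : Q ∉ AddSubgroup.zmultiples P) (hQm : (2 * m + 1) • Q = 0) :
    ∃ Q' ∉ AddSubgroup.zmultiples P, (2 * m + 1) • Q' = 0 ∧ ∃ (c : K) (r : W.Point → K),
      ∑ j ∈ Finset.range (2 * m + 1), r (j • P) = 0 ∧
      (c ≠ 0 ∨ ∃ T ∈ AddSubgroup.zmultiples P, r T ≠ 0) ∧
      ∀ T ∈ AddSubgroup.zmultiples P, slopeSum P (2 * m + 1) c r (Q' + T) = 0 := by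
  have hP0 : (2 * m + 1) • P = 0 := by rw [← hP, addOrderOf_nsmul_eq_zero]
  have hfin : IsOfFinAddOrder P := addOrderOf_pos_iff.mp (by omega)
  have hmem : ∀ k : ℕ, k • P ∈ AddSubgroup.zmultiples P :=
    fun k => AddSubgroup.nsmul_mem _ (AddSubgroup.mem_zmultiples P) k
  have hQT : ∀ k : ℕ, Q + k • P ∉ AddSubgroup.zmultiples P := fun k hk =>
    hQ ((AddSubgroup.add_mem_cancel_right _ (hmem k)).mp hk)
  obtain ⟨a, b, hab, ha, hb, hz⟩ := exists_eval_eq_zero (Finset.range (2 * m + 1)) m (by simp)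
    (fun k => Q + k • P) (fun k _ => ne_zero_of_notMem (hQT k)) (by
      rw [sum_range_nsmul_eq hP0 (fun T => Q + T), add_zero]
      have : ∀ T : W.Point, Q + T + (Q + -T) = 2 • Q := fun T => by abel
      simp only [this, Finset.sum_const, Finset.card_range]
      rw [← mul_smul, mul_comm, ← hQm, add_smul, one_smul])
  have hvan : ∃ Q' ∉ AddSubgroup.zmultiples P, (2 * m + 1) • Q' = 0 ∧
      ∀ T ∈ AddSubgroup.zmultiples P,
        a.eval (xCoord (Q' + T)) + b.eval (xCoord (Q' + T)) * yCoord (Q' + T) = 0 := by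
    rcases hz with hz | hz
    · refine ⟨Q, hQ, hQm, fun T hT => ?_⟩
      rw [hfin.mem_zmultiples_iff_mem_range_addOrderOf, hP] at hT
      obtain ⟨j, hj, rfl⟩ := Finset.mem_image.mp hT
      exact hz j hj
    · refine ⟨-Q, fun h => hQ (by simpa using h), by rw [smul_neg, hQm, neg_zero], fun T hT => ?_⟩
      rw [← neg_mem_iff, hfin.mem_zmultiples_iff_mem_range_addOrderOf, hP] at hT
      obtain ⟨j, hj, hjT⟩ := Finset.mem_image.mp hT
      have := hz j hj
      rwa [show -(Q + j • P) = -Q + T by rw [hjT]; abel] at this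
  obtain ⟨Q', hQ', hQ'm, hz⟩ := hvan
  have hinj := injOn_xCoord_nsmul hP
  set v : ℕ → K := fun i => xCoord ((i + 1) • P) with hv
  set V := Lagrange.nodal (Finset.range m) v with hV
  set c := a.coeff m with hc
  have hac : (a - C c * V).degree < (Finset.range m).card := by
    rw [Finset.card_range, degree_lt_iff_coeff_zero]
    intro k hk
    rw [coeff_sub, coeff_C_mul]
    have hVd : V.natDegree = m := by rw [hV, Lagrange.natDegree_nodal, Finset.card_range]
    rcases hk.eq_or_lt with rfl | hk
    · have : V.coeff m = 1 := by
        have := Lagrange.nodal_monic (s := Finset.range m) (v := v)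
        rwa [Monic, leadingCoeff, ← hV, hVd] at this
      rw [this, mul_one, sub_self]
    · rw [coeff_eq_zero_of_degree_lt (ha.trans_lt (by exact_mod_cast hk)),
        coeff_eq_zero_of_natDegree_lt (hVd.trans_lt hk), mul_zero, sub_zero]
  have hA := eq_sum_nodal_erase hinj hac
  have hB := eq_sum_nodal_erase hinj (b := b) (by simpa using hb)
  rw [← hV] at hA hB
  set τ : K → K := fun z => (a - C c * V).eval z / (derivative V).eval z with hτ
  set σ : K → K := fun z => b.eval z / (derivative V).eval z with hσ
  let r : W.Point → K := fun T =>
    (σ (xCoord T) * yCoord T + τ (xCoord T)) / (yCoord T - yCoord (-T)) +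
      open Classical in if T = 0 then -∑ i ∈ Finset.range m, σ (v i) else 0
  have hr0 : r 0 = -∑ i ∈ Finset.range m, σ (v i) := by simp [r]
  have hr1 : ∀ T : W.Point, T ≠ 0 → r T =
      (σ (xCoord T) * yCoord T + τ (xCoord T)) / (yCoord T - yCoord (-T)) := by
    intro T hT
    simp [r, hT]
  have solve : ∀ s t y y' : K, y ≠ y' →
      (s * y + t) / (y - y') + (s * y' + t) / (y' - y) = s ∧
      -((s * y + t) / (y - y') * y' + (s * y' + t) / (y' - y) * y) = t := by
    intro s t y y' h
    have d := sub_ne_zero.mpr h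
    rw [← neg_sub y y', div_neg]
    constructor <;> field_simp <;> ring
  have hrs : ∀ i < m, r ((i + 1) • P) + r (-((i + 1) • P)) = σ (v i) := by
    intro i hi
    have hT0 : (i + 1) • P ≠ 0 := nsmul_ne_zero_of_lt hP (by omega) (by omega)
    rw [hr1 _ hT0, hr1 _ (neg_ne_zero.mpr hT0), neg_neg, xCoord_neg]
    exact (solve _ _ _ _ (yCoord_nsmul_ne hP hi)).1
  have hrt : ∀ i < m, -(r ((i + 1) • P) * yCoord (-((i + 1) • P)) +
          r (-((i + 1) • P)) * yCoord ((i + 1) • P)) = τ (v i) := by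
    intro i hi
    have hT0 : (i + 1) • P ≠ 0 := nsmul_ne_zero_of_lt hP (by omega) (by omega)
    rw [hr1 _ hT0, hr1 _ (neg_ne_zero.mpr hT0), neg_neg, xCoord_neg]
    exact (solve _ _ _ _ (yCoord_nsmul_ne hP hi)).2
  refine ⟨Q', hQ', hQ'm, c, r, ?_, ?_, fun T hT => ?_⟩
  · rw [sum_range_nsmul_eq hP0, hr0, Finset.sum_congr rfl fun i hi => hrs i (Finset.mem_range.mp hi),
      add_neg_cancel]
  · by_contra! hcon
    have hσ0 : ∀ i < m, σ (v i) = 0 := fun i hi => by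
      rw [← hrs i hi, hcon.2 _ (hmem _), hcon.2 _ (neg_mem (hmem _)), add_zero]
    have hτ0 : ∀ i < m, τ (v i) = 0 := fun i hi => by
      rw [← hrt i hi, hcon.2 _ (hmem _), hcon.2 _ (neg_mem (hmem _))]
      ring
    rw [Finset.sum_eq_zero fun i hi => by
      rw [show b.eval (v i) / (derivative V).eval (v i) = 0 from
        hσ0 i (Finset.mem_range.mp hi)]; simp] at hB
    rw [Finset.sum_eq_zero fun i hi => by
      rw [show (a - C c * V).eval (v i) / (derivative V).eval (v i) = 0 from
        hτ0 i (Finset.mem_range.mp hi)]; simp, hcon.1] at hA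
    rcases hab with h | h
    · exact h (by simpa using hA)
    · exact h hB
  · have hX : Q' + T ∉ AddSubgroup.zmultiples P := fun hk =>
      hQ' ((AddSubgroup.add_mem_cancel_right _ hT).mp hk)
    have key := slopeSum_mul_nodal hP c r hX
    have eA : ∑ i ∈ Finset.range m, C (-(r ((i + 1) • P) * yCoord (-((i + 1) • P)) +
        r (-((i + 1) • P)) * yCoord ((i + 1) • P))) *
          Lagrange.nodal ((Finset.range m).erase i) v = a - C c * V :=
      (Finset.sum_congr rfl fun i hi => congrArg (fun z => C z * _)
        (hrt i (Finset.mem_range.mp hi))).trans hA.symm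
    have eB : ∑ i ∈ Finset.range m, C (r ((i + 1) • P) + r (-((i + 1) • P))) *
        Lagrange.nodal ((Finset.range m).erase i) v = b :=
      (Finset.sum_congr rfl fun i hi => congrArg (fun z => C z * _)
        (hrs i (Finset.mem_range.mp hi))).trans hB.symm
    rw [eA, eB, ← hV, add_sub_cancel, hz T hT] at key
    refine (mul_eq_zero.mp key).resolve_right ?_
    rw [hV, Lagrange.eval_nodal, ← ne_eq, Finset.prod_ne_zero_iff]
    intro i hi
    have hi' := Finset.mem_range.mp hi
    exact sub_ne_zero.mpr (xCoord_ne_of_notMem hX (hmem _)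
      (nsmul_ne_zero_of_lt hP (by omega) (by omega)))

end Torsion

end WeierstrassCurve.Affine.Point

namespace WeierstrassCurve.Affine.Point

variable {K : Type*} [Field K] {W : Affine K} [DecidableEq K]

lemma slopeFun_add_self {X P : W.Point} (hX : X ≠ 0) (hP : P ≠ 0) (hXP : xCoord X ≠ xCoord P)
    (hXPP : xCoord (X + P) ≠ xCoord P) :
    slopeFun (X + P) P = -slopeFun X (-P) - W.a₁ := by
  have hPX : P + X ≠ 0 := fun h => hXP (by rw [← neg_eq_of_add_eq_zero_right h, xCoord_neg])
  obtain ⟨hxy₁, hx₁, hy₁⟩ := coord_add hP hX hPX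
  have l₁ := slope_mul_sub (equation_coord hP) (equation_coord hX) hxy₁
  rw [slopeFun_of_ne _ hP, slopeFun_of_ne _ (neg_ne_zero.mpr hP), neg_neg, xCoord_neg,
    yCoord_neg hP]
  rw [add_comm X P] at hXPP ⊢
  have hs : W.slope (xCoord P) (xCoord X) (yCoord P) (yCoord X) =
      (yCoord X - yCoord P) / (xCoord X - xCoord P) := by
    rw [eq_div_iff (sub_ne_zero.mpr hXP), l₁]
  rw [← hs, div_eq_iff (sub_ne_zero.mpr hXPP), hy₁, hx₁]
  simp only [addY, negAddY, negY]
  ring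

/-- Translation by `P` acts on slope functions by shifting the pole. -/
lemma exists_slopeFun_add_eq {P : W.Point} (hP : P ≠ 0) :
    ∃ κ : W.Point → K, ∀ T ∈ AddSubgroup.zmultiples P, ∀ X ∉ AddSubgroup.zmultiples P,
      slopeFun (X + P) T = slopeFun X (T - P) - slopeFun X (-P) + κ T := by
  classical
  refine ⟨fun T => if T = 0 then 0 else if T = P then -W.a₁ else
    W.slope (xCoord P) (xCoord T) (yCoord P) (yCoord (-T)), fun T hT X hX => ?_⟩
  have hPm := AddSubgroup.mem_zmultiples P
  have hXPm : X + P ∉ AddSubgroup.zmultiples P := fun h =>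
    hX ((AddSubgroup.add_mem_cancel_right _ hPm).mp h)
  have hX0 := ne_zero_of_notMem hX
  by_cases hT0 : T = 0
  · simp [hT0]
  by_cases hTP : T = P
  · beta_reduce
    rw [if_neg hT0, if_pos hTP, hTP, sub_self, slopeFun_zero,
      slopeFun_add_self hX0 hP (xCoord_ne_of_notMem hX hPm hP) (xCoord_ne_of_notMem hXPm hPm hP)]
    ring
  · beta_reduce
    rw [if_neg hT0, if_neg hTP]
    exact slopeFun_add_of_ne hX0 hP hT0 hTP (xCoord_ne_of_notMem hX hPm hP)
      (xCoord_ne_of_notMem hXPm hT hT0)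
      (xCoord_ne_of_notMem hX (sub_mem hT hPm) (sub_ne_zero.mpr hTP))

lemma sum_range_nsmul_add {M : Type*} [AddCommMonoid M] [IsCancelAdd M] {P : W.Point} {n : ℕ}
    (hP : n • P = 0) (f : W.Point → M) :
    ∑ j ∈ Finset.range n, f (j • P + P) = ∑ j ∈ Finset.range n, f (j • P) := by
  have h := Finset.sum_range_succ (fun j => f (j • P)) n
  rw [Finset.sum_range_succ', hP, zero_smul] at h
  simpa only [add_smul, one_smul] using add_right_cancel h

lemma exists_slopeSum_add_eq {P : W.Point} (hP : P ≠ 0) {n : ℕ} (hn : n • P = 0) (c : K)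
    (r : W.Point → K) (hr : ∑ j ∈ Finset.range n, r (j • P) = 0) :
    ∃ c' : K, ∀ X ∉ AddSubgroup.zmultiples P,
      slopeSum P n c r (X + P) = slopeSum P n c' (fun T => r (T + P)) X := by
  obtain ⟨κ, hκ⟩ := exists_slopeFun_add_eq hP
  refine ⟨c + ∑ j ∈ Finset.range n, r (j • P) * κ (j • P), fun X hX => ?_⟩
  have h1 : ∀ j : ℕ, r (j • P) * slopeFun (X + P) (j • P) =
      r (j • P) * slopeFun X (j • P - P) - r (j • P) * slopeFun X (-P) +
        r (j • P) * κ (j • P) := fun j => by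
    rw [hκ _ (AddSubgroup.nsmul_mem _ (AddSubgroup.mem_zmultiples P) _) X hX]
    ring
  have h2 := sum_range_nsmul_add hn fun T => r T * slopeFun X (T - P)
  simp only [add_sub_cancel_right] at h2
  rw [slopeSum, slopeSum, Finset.sum_congr rfl fun j _ => h1 j, Finset.sum_add_distrib,
    Finset.sum_sub_distrib, ← Finset.sum_mul, hr, h2]
  ring

/-- If `W` has two independent rational `p`-torsion points, then the base field contains a
primitive `p`-th root of unity. -/
theorem exists_isPrimitiveRoot_of_notMem_zmultiples {p : ℕ} (hp : p.Prime) (hp2 : p ≠ 2)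
    (hpK : (p : K) ≠ 0) {P Q : W.Point} (hP : p • P = 0) (hP0 : P ≠ 0) (hQp : p • Q = 0)
    (hQ : Q ∉ AddSubgroup.zmultiples P) : ∃ ζ : K, IsPrimitiveRoot ζ p := by
  have := Fact.mk hp
  have hord := addOrderOf_eq_prime hP hP0
  obtain ⟨m, rfl⟩ := hp.odd_of_ne_two hp2
  obtain ⟨Q, hQ, hQp, c, r, hr, hne, hvan⟩ := exists_slopeSum_eq_zero hord hQ hQp
  have hr0 : r 0 ≠ 0 := by
    intro h0
    obtain ⟨hc, hT⟩ := slopeSum_eq_zero hord hQ hQp hr h0 hvan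
    rcases hne with h | ⟨T, hTm, h⟩
    · exact h hc
    · exact h (hT T hTm)
  obtain ⟨c', hc'⟩ := exists_slopeSum_add_eq hP0 hP c r hr
  set ζ := r P / r 0 with hζ
  have hPm := AddSubgroup.mem_zmultiples P
  have key : ∀ T ∈ AddSubgroup.zmultiples P, r (T + P) - ζ * r T = 0 := by
    refine (slopeSum_eq_zero hord hQ hQp (c := c' - ζ * c) (r := fun T => r (T + P) - ζ * r T)
      ?_ ?_ fun T hT => ?_).2
    · rw [Finset.sum_sub_distrib, ← Finset.mul_sum, sum_range_nsmul_add hP r, hr, mul_zero,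
        sub_zero]
    · rw [zero_add, hζ, div_mul_cancel₀ _ hr0, sub_self]
    · have e1 := hvan T hT
      have e2 := hvan (T + P) (add_mem hT hPm)
      rw [← add_assoc, hc' _ fun h => hQ ((AddSubgroup.add_mem_cancel_right _ hT).mp h)] at e2
      have e3 : slopeSum P (2 * m + 1) (c' - ζ * c) (fun T => r (T + P) - ζ * r T) (Q + T) =
          slopeSum P (2 * m + 1) c' (fun T => r (T + P)) (Q + T) -
            ζ * slopeSum P (2 * m + 1) c r (Q + T) := by
        simp only [slopeSum, sub_mul, Finset.sum_sub_distrib, mul_add, Finset.mul_sum, mul_assoc]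
        ring
      rw [e3, e1, e2, mul_zero, sub_zero]
  have hpow : ∀ j : ℕ, r (j • P) = ζ ^ j * r 0 := by
    intro j
    induction j with
    | zero => simp
    | succ j ih =>
      rw [add_smul, one_smul, sub_eq_zero.mp (key _ (AddSubgroup.nsmul_mem _ hPm j)), ih]
      ring
  have hζp : ζ ^ (2 * m + 1) = 1 := by
    have h := hpow (2 * m + 1)
    rw [hP] at h
    exact (mul_right_cancel₀ hr0 (by rw [one_mul]; exact h)).symm
  refine ⟨ζ, IsPrimitiveRoot.iff_orderOf.mpr (orderOf_eq_prime hζp fun h1 => ?_)⟩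
  simp only [hpow, h1, one_pow, one_mul, Finset.sum_const, Finset.card_range, nsmul_eq_mul] at hr
  exact (mul_ne_zero hpK hr0) hr

end WeierstrassCurve.Affine.Point

lemma hasCyclicQuotientOfOrder_finrank_cyclotomicField {F N : Type*} [Field F] [Field N]
    [Algebra F N] [Normal F N] {p : ℕ} (hp : p.Prime) [NeZero (p : F)] {ζ : N}
    (hζ : IsPrimitiveRoot ζ p) :
    HasCyclicQuotientOfOrder (N ≃ₐ[F] N) (Module.finrank F (CyclotomicField p F)) := by
  have := Fact.mk hp
  let M := IntermediateField.adjoin F {ζ}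
  have hM : IsCyclotomicExtension {p} F M := hζ.intermediateField_adjoin_isCyclotomicExtension F
  have hgal : IsGalois F M := IsCyclotomicExtension.isGalois {p} F M
  have : FiniteDimensional F M := IsCyclotomicExtension.finiteDimensional {p} F M
  have hcyc : IsCyclic (M ≃ₐ[F] M) :=
    isCyclic_of_injective _ (IsPrimitiveRoot.autToPow_injective F
      (IsCyclotomicExtension.zeta_spec p F M))
  let e := QuotientGroup.quotientKerEquivOfSurjective
    (AlgEquiv.restrictNormalHom M : (N ≃ₐ[F] N) →* (M ≃ₐ[F] M))
    (AlgEquiv.restrictNormalHom_surjective N)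
  refine ⟨(AlgEquiv.restrictNormalHom M : (N ≃ₐ[F] N) →* (M ≃ₐ[F] M)).ker, inferInstance,
    isCyclic_of_injective e.toMonoidHom e.injective, ?_⟩
  rw [Nat.card_congr e.toEquiv, IsGalois.card_aut_eq_finrank]
  exact (IsCyclotomicExtension.algEquiv {p} F M (CyclotomicField p F)).toLinearEquiv.finrank_eq

namespace WeierstrassCurve.Affine.Point

variable {F N : Type*} [Field F] [Field N] [Algebra F N] [DecidableEq N] {E : Affine F}

/-- The stabilizer of a point in the group of automorphisms of the field of definition. -/
def galStabilizer (P : (E⁄N).Point) : Subgroup (N ≃ₐ[F] N) where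
  carrier := {σ | map (σ : N →ₐ[F] N) P = P}
  one_mem' := map_id P
  mul_mem' {σ τ} hσ hτ := by
    have h := map_map (τ : N →ₐ[F] N) (σ : N →ₐ[F] N) P
    rw [Set.mem_ofPred_eq.mp hτ, Set.mem_ofPred_eq.mp hσ] at h
    exact h.symm
  inv_mem' {σ} hσ := by
    have h := map_map (σ : N →ₐ[F] N) ((σ⁻¹ : N ≃ₐ[F] N) : N →ₐ[F] N) P
    rw [Set.mem_ofPred_eq.mp hσ] at h
    have hid : ((σ⁻¹ : N ≃ₐ[F] N) : N →ₐ[F] N).comp (σ : N →ₐ[F] N) = AlgHom.id F N :=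
      AlgHom.ext fun x => σ.symm_apply_apply x
    rw [hid] at h
    exact h.trans (map_id P)

lemma mem_galStabilizer {P : (E⁄N).Point} {σ : N ≃ₐ[F] N} :
    σ ∈ galStabilizer P ↔ map (σ : N →ₐ[F] N) P = P := Iff.rfl

lemma map_mul (σ τ : N ≃ₐ[F] N) (P : (E⁄N).Point) :
    map ((σ * τ : N ≃ₐ[F] N) : N →ₐ[F] N) P =
      map (σ : N →ₐ[F] N) (map (τ : N →ₐ[F] N) P) :=
  (map_map (τ : N →ₐ[F] N) (σ : N →ₐ[F] N) P).symm

/-- The stabilizer of a point is normal if every conjugate of the point is a multiple of it. -/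
lemma normal_galStabilizer {P : (E⁄N).Point}
    (h : ∀ σ : N ≃ₐ[F] N, map (σ : N →ₐ[F] N) P ∈ AddSubgroup.zmultiples P) :
    (galStabilizer P).Normal := by
  refine ⟨fun τ hτ σ => ?_⟩
  rw [mem_galStabilizer] at hτ ⊢
  obtain ⟨k, hk⟩ := AddSubgroup.mem_zmultiples_iff.mp (h σ⁻¹)
  rw [map_mul, ← hk, map_mul, map_zsmul, hτ, hk, ← map_mul, mul_inv_cancel]
  exact map_id P

/-- A point fixed by all automorphisms of a Galois extension is defined over the base field. -/
lemma exists_baseChange_eq_of_galStabilizer_eq_top [DecidableEq F] [IsGalois F N]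
    {P : (E⁄N).Point} (h : galStabilizer P = ⊤) : ∃ P₀ : (E⁄F).Point, baseChange F N P₀ = P := by
  have hfix : ∀ σ : N ≃ₐ[F] N, map (σ : N →ₐ[F] N) P = P := fun σ =>
    mem_galStabilizer.mp (h ▸ Subgroup.mem_top σ)
  rcases P with _ | ⟨x, y, hxy⟩
  · exact ⟨0, rfl⟩
  · have hx : ∀ σ : N ≃ₐ[F] N, σ x = x := fun σ => (Point.some.inj (hfix σ)).1
    have hy : ∀ σ : N ≃ₐ[F] N, σ y = y := fun σ => (Point.some.inj (hfix σ)).2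
    obtain ⟨x₀, rfl⟩ := (InfiniteGalois.mem_range_algebraMap_iff_fixed x).mpr hx
    obtain ⟨y₀, rfl⟩ := (InfiniteGalois.mem_range_algebraMap_iff_fixed y).mpr hy
    exact ⟨some x₀ y₀ ((E.baseChange_nonsingular (f := Algebra.ofId F N)
      (Algebra.ofId F N).injective x₀ y₀).mp hxy), rfl⟩

end WeierstrassCurve.Affine.Point

theorem mainTheorem7 {F L N : Type*} [Field F] [NumberField F] [Field L] [NumberField L]
    [Field N] [Algebra F L] [Algebra F N] [Algebra L N] [IsScalarTower F L N]
    [DecidableEq F] [DecidableEq L]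
    (hN : IsNormalClosure F L N)
    (hmax : IsCoatom (relGal F L N)) (hnormal : ¬ (relGal F L N).Normal)
    (p : ℕ) (hp : p.Prime)
    (hcyc : ¬ HasCyclicQuotientOfOrder (N ≃ₐ[F] N) (Module.finrank F (CyclotomicField p F)))
    (E : WeierstrassCurve F) (hE : E.IsElliptic) :
    AddSubgroup.torsionBy (E.baseChange L).toAffine.Point (p : ℤ) =
      (AddSubgroup.torsionBy (E.baseChange F).toAffine.Point (p : ℤ)).map
        (WeierstrassCurve.Affine.Point.baseChange (W' := E) F L) := by
  classical
  have : Normal F N := hN.normal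
  have : IsGalois F N := ⟨⟩
  have : CharZero N := charZero_of_injective_algebraMap (algebraMap F N).injective
  have : NeZero (p : F) := ⟨Nat.cast_ne_zero.mpr hp.ne_zero⟩
  have hroot : ∀ ζ : N, ¬ IsPrimitiveRoot ζ p := fun ζ hζ =>
    hcyc (hasCyclicQuotientOfOrder_finrank_cyclotomicField hp hζ)
  have hp2 : p ≠ 2 := by
    rintro rfl
    exact hroot (-1) (IsPrimitiveRoot.neg_one 0 (by norm_num))
  ext P
  rw [AddSubgroup.mem_map]
  constructor
  swap
  · rintro ⟨P₀, hP₀, rfl⟩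
    change (p : ℤ) • P₀ = 0 at hP₀
    change (p : ℤ) • Point.baseChange F L P₀ = 0
    rw [← map_zsmul, hP₀, _root_.map_zero]
  intro hP
  change (p : ℤ) • P = 0 at hP
  let f : L →ₐ[F] N := IsScalarTower.toAlgHom F L N
  have hle : relGal F L N ≤ Point.galStabilizer (Point.map (W' := E) f P) := by
    intro σ hσ
    have hcomp : (σ : N →ₐ[F] N).comp f = f := AlgHom.ext fun x =>
      (IntermediateField.mem_fixingSubgroup_iff _ _).mp hσ (f x) ⟨x, rfl⟩
    rw [Point.mem_galStabilizer, Point.map_map, hcomp]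
  have htors : p • Point.map (W' := E) f P = 0 := by
    rw [← map_nsmul, ← natCast_zsmul, hP, _root_.map_zero]
  rcases hmax.le_iff.mp hle with htop | heq
  · obtain ⟨P₀, hP₀⟩ := Point.exists_baseChange_eq_of_galStabilizer_eq_top htop
    refine ⟨P₀, ?_, ?_⟩
    · change (p : ℤ) • P₀ = 0
      apply Point.map_injective (W' := E) (Algebra.ofId F N)
      rw [map_zsmul, hP₀, natCast_zsmul, htors, _root_.map_zero]
    · apply Point.map_injective (W' := E) f
      rw [← hP₀]
      exact Point.map_baseChange f P₀
  · exfalso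
    have hex : ∃ σ : N ≃ₐ[F] N, Point.map (σ : N →ₐ[F] N) (Point.map (W' := E) f P) ∉
        AddSubgroup.zmultiples (Point.map (W' := E) f P) := by
      by_contra! h
      exact hnormal (heq ▸ Point.normal_galStabilizer h)
    obtain ⟨σ, hσ⟩ := hex
    obtain ⟨ζ, hζ⟩ := Point.exists_isPrimitiveRoot_of_notMem_zmultiples hp hp2
      (Nat.cast_ne_zero.mpr hp.ne_zero) htors
      (fun h0 => hσ (by rw [h0, _root_.map_zero]; exact zero_mem _))
      (by rw [← map_nsmul, htors, _root_.map_zero]) hσ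
    exact hroot ζ hζ
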